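/- For positive integers $a_1,\dots,a_k$, let the $k$-chain $C_{a_1,\dots,a_k}$ be the graph whose vertex set is a disjoint union of sets $A_1,\dots,A_k$ with $|A_i|=a_i$, and in which two vertices are adjacent exactly when one lies in $A_i$ and the other in $A_{i+1}$ for some $1\le i\le k-1$. For a graph $G=(V,E)$ and a realization $p:V\to\mathbb{R}^d$, a stress of $G(p)$ is a vector $\omega\in\mathbb{R}^E$ such that $\sum_{j:\{i,j\}\in E}\omega_{ij}\,(p_j-p_i)=0$ for every $i\in V$. A realization is generic if its $|V|\,d$ coordinates are algebraically independent over $\mathbb{Q}$. **Lemma 4.1.** Let $k\ge 4$, and let $C_{a_1,\dots,a_k}$ be a $k$-chain that is vertex $(d+1)$-connected and has $a_1+\cdots+a_k=\binom{d+2}{2}$ vertices. Then for every generic realization $p$ of $C_{a_1,\dots,a_k}$ in $\mathbb{R}^d$, the space of stresses of $C_{a_1,\dots,a_k}(p)$ equals the sum, over $1\le i\le k-2$, of the spaces of stresses of the sub-frameworks $C_{a_i,a_{i+1},a_{i+2}}(p|_{A_i\cup A_{i+1}\cup A_{i+2}})$, where each stress of a $3$-chain is extended by zero to the other edges of the $k$-chain.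 -/

import Mathlib

/-- Vertex `n`-connectedness: there are more than `n` vertices, and deleting any fewer than `n`
vertices leaves a connected graph. -/
def IsVertexConnected {V : Type*} (G : SimpleGraph V) (n : ℕ) : Prop :=
  n < Nat.card V ∧ ∀ S : Finset V, S.card < n → (G.induce ((S : Set V)ᶜ)).Connected

/-- A realization in `ℝ^d` is generic if its coordinates are algebraically independent over `ℚ`. -/
def IsGenericRealization {V : Type*} {d : ℕ} (p : V → EuclideanSpace ℝ (Fin d)) : Prop :=
  AlgebraicIndependent ℚ (fun x : V × Fin d => p x.1 x.2)

open Classical in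
/-- The space of equilibrium stresses of the framework `G(p)`: vectors `ω` indexed by the edges
such that at every vertex `i` the sum of `ω_{ij} (p_j - p_i)` over the neighbours `j` vanishes. -/
noncomputable def stressSpace {V : Type*} [Fintype V] {d : ℕ} (G : SimpleGraph V)
    (p : V → EuclideanSpace ℝ (Fin d)) : Submodule ℝ (G.edgeSet → ℝ) where
  carrier := {ω | ∀ i : V, ∑ j : {j : V // G.Adj i j},
    ω ⟨s(i, j.1), j.2⟩ • (p j.1 - p i) = 0}
  zero_mem' := by
    intro i
    simp
  add_mem' := by
    intro ω₁ ω₂ h₁ h₂ i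
    simp only [Pi.add_apply, add_smul, Finset.sum_add_distrib]
    rw [h₁ i, h₂ i, add_zero]
  smul_mem' := by
    intro c ω h i
    simp only [Pi.smul_apply, smul_eq_mul, mul_smul, ← Finset.smul_sum]
    rw [h i, smul_zero]

/-- The `k`-chain `C_{a_1,…,a_k}`: the `i`-th vertex class is `Fin (a i)`, and two vertices are
adjacent exactly when they lie in consecutive classes. -/
def kChain {k : ℕ} (a : Fin k → ℕ) : SimpleGraph (Σ i : Fin k, Fin (a i)) where
  Adj x y := (x.1 : ℕ) + 1 = y.1 ∨ (y.1 : ℕ) + 1 = x.1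
  symm := ⟨fun _ _ h => h.symm⟩
  loopless := ⟨fun _ h => by omega⟩

/-- The sizes of the three consecutive classes of a `k`-chain that start at class `i`. -/
def threeSizes {k : ℕ} (a : Fin k → ℕ) (i : Fin (k - 2)) : Fin 3 → ℕ :=
  fun j => a ⟨i + j, by omega⟩

/-- The `3`-chain on three consecutive classes as a subgraph of the `k`-chain. -/
def threeChainEmbedding {k : ℕ} (a : Fin k → ℕ) (i : Fin (k - 2)) :
    kChain (threeSizes a i) ↪g kChain a where
  toFun x := ⟨⟨i + x.1, by omega⟩, x.2⟩
  inj' := by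
    rintro ⟨j, x⟩ ⟨j', x'⟩ h
    have hj : j = j' := by
      have := congrArg (fun z => (z.1 : ℕ)) h
      apply Fin.ext
      simpa using this
    subst hj
    have hx : x = x' := eq_of_heq (Sigma.mk.inj h).2
    rw [hx]
  map_rel_iff' := by
    rintro ⟨j, x⟩ ⟨j', x'⟩
    change ((i : ℕ) + j + 1 = i + j' ∨ (i : ℕ) + j' + 1 = i + j) ↔
      ((j : ℕ) + 1 = j' ∨ (j' : ℕ) + 1 = j)
    omega

/-- The space of stresses of the `3`-chain cover of a `k`-chain with realization `p`: the sum, over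
all `3`-chains of consecutive classes, of the spaces of stresses of these `3`-chains, each stress
being extended by zero to the remaining edges of the `k`-chain. -/
noncomputable def coverStressSpace {k d : ℕ} (a : Fin k → ℕ)
    (p : (Σ i : Fin k, Fin (a i)) → EuclideanSpace ℝ (Fin d)) :
    Submodule ℝ ((kChain a).edgeSet → ℝ) :=
  ⨆ i : Fin (k - 2),
    (stressSpace (kChain (threeSizes a i)) (p ∘ threeChainEmbedding a i)).map
      (Function.ExtendByZero.linearMap ℝ (threeChainEmbedding a i).mapEdgeSet)

/-!
Write `v̂ = (1, p v)` for the homogeneous coordinates of a vertex. A stress `ω` satisfies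
`∑ u, ω_vu û = μ_v v̂` with `μ_v = ∑ u, ω_vu`. A chain is bipartite; with signs `ε_v = ±1` for the
two colour classes, the symmetric tensor `∑ v, ε_v μ_v v̂ ⊗ v̂ = ∑ v u, ε_v ω_vu û ⊗ v̂` is also
antisymmetric, so it is zero. There are as many vertices as monomials of degree at most two, hence
the squares `v̂ ⊗ v̂` of generic points are linearly independent (`det_monomials_ne_zero`), and all
`μ_v` vanish: every stress is *balanced*, `∑ u, ω_vu û = 0` (`isBalanced_of_mem_stressSpace`).

Balanced weights can be peeled off class by class. Let `t` be the first class that meets the support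
of `ω`. If `t + 3` is still a class, then the class `t + 2` is a separator, so by connectivity it has
at least `d + 1` vertices (`le_size_of_isVertexConnected`), and these affinely span. The force
`X u = ∑ z, ω_uz ẑ` that the class `t` exerts on the vertices `u` of the class `t + 1` can therefore
be cancelled by weights on the edges to the class `t + 2` that depend linearly on `X u`; since
`∑ u, X u ⊗ û = 0`, this keeps the vertices of the class `t + 2` balanced. This gives a stress of a
`3`-chain that agrees with `ω` at the class `t` (`exists_balanced_on_three_classes`). Subtracting it
moves the support to later classes, until only a `3`-chain is left.
-/

/-! ### Monomials at generic points -/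

/-- The homogeneous coordinates `(1, p)` of a point `p`, with `none` as the extra coordinate. -/
def homogeneousCoord {d : ℕ} (p : EuclideanSpace ℝ (Fin d)) (x : Option (Fin d)) : ℝ :=
  x.elim 1 (fun l => p l)

/-- The exponent of the monomial that the homogeneous coordinate `x` stands for. -/
noncomputable def homogeneousExponent {d : ℕ} (x : Option (Fin d)) : Fin d →₀ ℕ :=
  x.elim 0 (fun l => Finsupp.single l 1)

/-- The exponent of the monomial of degree at most two that is the product of two homogeneous
coordinates. -/
noncomputable def quadraticExponent {d : ℕ} : Sym2 (Option (Fin d)) → (Fin d →₀ ℕ) :=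
  Sym2.lift ⟨fun x y => homogeneousExponent x + homogeneousExponent y, fun _ _ => add_comm _ _⟩

theorem homogeneousExponent_injective {d : ℕ} :
    Function.Injective (homogeneousExponent (d := d)) := by
  rintro (_ | l) (_ | l') h
  · rfl
  · simp [homogeneousExponent, eq_comm] at h
  · simp [homogeneousExponent] at h
  · simp [homogeneousExponent, Finsupp.single_left_inj] at h
    rw [h]

theorem quadraticExponent_injective {d : ℕ} :
    Function.Injective (quadraticExponent (d := d)) := by
  intro s t
  induction s with | _ x y
  induction t with | _ x' y'
  intro h
  have hd := congrArg Finsupp.degree h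
  rcases x with _ | x <;> rcases y with _ | y <;> rcases x' with _ | x' <;>
    rcases y' with _ | y' <;>
    simp [quadraticExponent, homogeneousExponent, Finsupp.single_left_inj,
      Finsupp.single_add_single_eq_single_add_single] at h hd ⊢ <;> tauto

theorem prod_pow_homogeneousExponent {d : ℕ} (p : EuclideanSpace ℝ (Fin d))
    (x : Option (Fin d)) :
    ∏ l, p l ^ homogeneousExponent x l = homogeneousCoord p x := by
  rcases x with _ | l
  · simp [homogeneousExponent, homogeneousCoord]
  · simp [homogeneousExponent, homogeneousCoord, Finsupp.single_apply]

theorem prod_pow_quadraticExponent {d : ℕ} (p : EuclideanSpace ℝ (Fin d))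
    (x y : Option (Fin d)) :
    ∏ l, p l ^ quadraticExponent s(x, y) l = homogeneousCoord p x * homogeneousCoord p y := by
  simp [quadraticExponent, pow_add, Finset.prod_mul_distrib, prod_pow_homogeneousExponent]

/-- Distinct monomials evaluated at as many distinct generic points give a nonsingular matrix: in
the expansion of the determinant the terms of different permutations are different monomials. -/
theorem det_monomials_ne_zero {V ι : Type*} [Fintype ι] [DecidableEq ι] {d : ℕ}
    {p : V → EuclideanSpace ℝ (Fin d)} (hp : IsGenericRealization p) {v : ι → V}
    (hv : Function.Injective v) {m : ι → (Fin d →₀ ℕ)} (hm : Function.Injective m) :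
    (Matrix.of fun i j => ∏ l, p (v i) l ^ m j l).det ≠ 0 := by
  classical
  let e : ι → ι → (V × Fin d →₀ ℕ) := fun i j => (m j).mapDomain (fun l => (v i, l))
  have inj : ∀ i, Function.Injective (fun l : Fin d => (v i, l)) := fun i l l' h => by simpa using h
  let M : Matrix ι ι (MvPolynomial (V × Fin d) ℚ) :=
    Matrix.of fun i j => MvPolynomial.monomial (e i j) 1
  have hM : M.det ≠ 0 := by
    have key : ∀ σ : Equiv.Perm ι, ∑ i, e i (σ i) = ∑ i, e i i → σ = 1 := by
      intro σ h
      ext i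
      apply hm
      ext l
      have hl := DFunLike.congr_fun h (v i, l)
      have aux : ∀ τ : Equiv.Perm ι, (∑ j, e j (τ j)) (v i, l) = m (τ i) l := by
        intro τ
        rw [Finsupp.finsetSum_apply, Finset.sum_eq_single i]
        · exact Finsupp.mapDomain_apply (inj i) _ _
        · intro j _ hj
          apply Finsupp.mapDomain_of_notMem_range
          rintro ⟨l', h'⟩
          exact hj (hv (congrArg Prod.fst h'))
        · simp
      simpa [aux σ] using hl.trans (aux 1)
    intro h0
    have hc := congrArg (MvPolynomial.coeff (∑ i, e i i)) h0
    have hprod : ∀ σ : Equiv.Perm ι, ∏ i, M i (σ i) =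
        MvPolynomial.monomial (∑ i, e i (σ i)) 1 := by
      intro σ
      simp only [M, Matrix.of_apply]
      exact (MvPolynomial.monomial_sum_one _ _).symm
    rw [← Matrix.det_transpose, Matrix.det_apply, MvPolynomial.coeff_sum,
      Finset.sum_eq_single 1] at hc
    · have h1 := hprod 1
      simp only [Equiv.Perm.coe_one, id_eq] at h1
      simp [Matrix.transpose_apply, h1, MvPolynomial.coeff_monomial] at hc
    · intro σ _ hσ
      simp only [Matrix.transpose_apply, hprod]
      rw [MvPolynomial.coeff_smul, MvPolynomial.coeff_monomial, if_neg fun h => hσ (key σ h),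
        smul_zero]
    · simp
  intro h0
  refine hM ((injective_iff_map_eq_zero _).1 hp _ ?_)
  rw [AlgHom.map_det, ← h0]
  congr 1
  ext i j
  simp only [M, e, AlgHom.mapMatrix_apply, Matrix.map_apply, Matrix.of_apply,
    MvPolynomial.aeval_monomial, map_one, one_mul]
  rw [Finsupp.prod_mapDomain_index_inj (inj i), Finsupp.prod_fintype]
  simp

/-- Any `d + 1` generic points affinely span: the basis vector of each homogeneous coordinate `x` is
a combination, with weights `R x`, of the homogeneous coordinate vectors of the points in `s`. -/
theorem exists_dual_weights {V : Type*} [Fintype V] {d : ℕ}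
    {p : V → EuclideanSpace ℝ (Fin d)} (hp : IsGenericRealization p) (s : Finset V)
    (hs : d + 1 ≤ s.card) :
    ∃ R : Option (Fin d) → V → ℝ, (∀ x, ∀ v ∉ s, R x v = 0) ∧
      ∀ x y, ∑ v, R x v * homogeneousCoord (p v) y = if x = y then 1 else 0 := by
  classical
  obtain ⟨f⟩ : Nonempty (Option (Fin d) ↪ s) :=
    Function.Embedding.nonempty_of_card_le (by simpa using hs)
  let g : Option (Fin d) → V := fun x => f x
  have hg : Function.Injective g := Subtype.val_injective.comp f.injective
  have hdet := det_monomials_ne_zero hp hg homogeneousExponent_injective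
  simp only [prod_pow_homogeneousExponent] at hdet
  set M : Matrix (Option (Fin d)) (Option (Fin d)) ℝ :=
    Matrix.of fun i j => homogeneousCoord (p (g i)) j
  refine ⟨fun x v => ∑ i, if g i = v then M⁻¹ x i else 0, ?_, ?_⟩
  · intro x v hv
    refine Finset.sum_eq_zero fun i _ => if_neg ?_
    rintro rfl
    exact hv (f i).2
  · intro x y
    have h := congrFun (congrFun (Matrix.nonsing_inv_mul M (isUnit_iff_ne_zero.2 hdet)) x) y
    rw [Matrix.mul_apply, Matrix.one_apply] at h
    rw [← h]
    simp only [Finset.sum_mul]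
    rw [Finset.sum_comm]
    simp [M, ite_mul]

/-- No nontrivial combination of the symmetric squares of generic points vanishes if there are
`(d + 2).choose 2` points, the number of monomials of degree at most two. -/
theorem eq_zero_of_sum_quadratic_eq_zero {V : Type*} [Fintype V] {d : ℕ}
    {p : V → EuclideanSpace ℝ (Fin d)} (hp : IsGenericRealization p)
    (hV : Fintype.card V = (d + 2).choose 2) (c : V → ℝ)
    (hc : ∀ x y, ∑ v, c v * (homogeneousCoord (p v) x * homogeneousCoord (p v) y) = 0) :
    c = 0 := by
  classical
  have e : V ≃ Sym2 (Option (Fin d)) := Fintype.equivOfCardEq (by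
    rw [hV, Sym2.card, Fintype.card_option, Fintype.card_fin])
  have hdet := det_monomials_ne_zero hp Function.injective_id
    (quadraticExponent_injective.comp e.injective)
  refine Matrix.eq_zero_of_vecMul_eq_zero hdet ?_
  ext j
  simp only [Matrix.vecMul, dotProduct, Matrix.of_apply, id, Function.comp_apply, Pi.zero_apply]
  obtain ⟨x, y, hxy⟩ : ∃ x y, e j = s(x, y) := by
    induction e j with | _ x y
    exact ⟨x, y, rfl⟩
  simp only [hxy, prod_pow_quadraticExponent, hc]

/-! ### Stresses as weight functions -/

open Classical in
/-- The symmetric weight function on pairs of vertices that a vector on the edges defines, zero on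
non-adjacent pairs. -/
noncomputable def edgeWeight {V : Type*} (G : SimpleGraph V) (ω : G.edgeSet → ℝ) (u v : V) : ℝ :=
  if h : G.Adj u v then ω ⟨s(u, v), h⟩ else 0

theorem edgeWeight_of_adj {V : Type*} {G : SimpleGraph V} (ω : G.edgeSet → ℝ) {u v : V}
    (h : G.Adj u v) : edgeWeight G ω u v = ω ⟨s(u, v), h⟩ := dif_pos h

theorem edgeWeight_of_not_adj {V : Type*} {G : SimpleGraph V} (ω : G.edgeSet → ℝ) {u v : V}
    (h : ¬ G.Adj u v) : edgeWeight G ω u v = 0 := dif_neg h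

theorem edgeWeight_comm {V : Type*} {G : SimpleGraph V} (ω : G.edgeSet → ℝ) (u v : V) :
    edgeWeight G ω u v = edgeWeight G ω v u := by
  by_cases h : G.Adj u v
  · rw [edgeWeight_of_adj ω h, edgeWeight_of_adj ω h.symm]
    congr 2
    exact Sym2.eq_swap
  · rw [edgeWeight_of_not_adj ω h, edgeWeight_of_not_adj ω fun h' => h h'.symm]

theorem exists_edgeWeight_eq {V : Type*} {G : SimpleGraph V} (w : V → V → ℝ)
    (hcomm : ∀ u v, w u v = w v u) (hadj : ∀ u v, w u v ≠ 0 → G.Adj u v) :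
    ∃ ω : G.edgeSet → ℝ, edgeWeight G ω = w := by
  refine ⟨fun e => Sym2.lift ⟨w, hcomm⟩ e.1, ?_⟩
  ext u v
  by_cases h : G.Adj u v
  · rw [edgeWeight_of_adj _ h]
    rfl
  · rw [edgeWeight_of_not_adj _ h]
    by_contra h'
    exact h (hadj u v (Ne.symm h'))

theorem mem_stressSpace_iff {V : Type*} [Fintype V] {d : ℕ} {G : SimpleGraph V}
    {p : V → EuclideanSpace ℝ (Fin d)} {ω : G.edgeSet → ℝ} :
    ω ∈ stressSpace G p ↔ ∀ u, ∑ v, edgeWeight G ω u v • (p v - p u) = 0 := by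
  classical
  refine forall_congr' fun u => ?_
  have h : ∑ v, edgeWeight G ω u v • (p v - p u) =
      ∑ j : {j : V // G.Adj u j}, ω ⟨s(u, j.1), j.2⟩ • (p j.1 - p u) := by
    refine (Fintype.sum_of_injective Subtype.val Subtype.val_injective _ _ ?_ ?_).symm
    · intro v hv
      rw [edgeWeight_of_not_adj ω fun h => hv ⟨⟨v, h⟩, rfl⟩, zero_smul]
    · intro j
      rw [edgeWeight_of_adj ω j.2]
  rw [h]

theorem edgeWeight_sub {V : Type*} {G : SimpleGraph V} (ω₁ ω₂ : G.edgeSet → ℝ) (u v : V) :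
    edgeWeight G (ω₁ - ω₂) u v = edgeWeight G ω₁ u v - edgeWeight G ω₂ u v := by
  by_cases h : G.Adj u v
  · simp [edgeWeight_of_adj _ h]
  · simp [edgeWeight_of_not_adj _ h]

/-- A weight function on pairs of vertices is balanced if at every vertex the weighted sum of the
homogeneous coordinates of the other vertices vanishes; equivalently, it is an equilibrium stress
whose weights at each vertex add up to zero. -/
def IsBalanced {V : Type*} [Fintype V] {d : ℕ} (p : V → EuclideanSpace ℝ (Fin d))
    (w : V → V → ℝ) : Prop :=
  ∀ u x, ∑ v, w u v * homogeneousCoord (p v) x = 0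

theorem IsBalanced.mem_stressSpace {V : Type*} [Fintype V] {d : ℕ} {G : SimpleGraph V}
    {p : V → EuclideanSpace ℝ (Fin d)} {ω : G.edgeSet → ℝ} (h : IsBalanced p (edgeWeight G ω)) :
    ω ∈ stressSpace G p := by
  refine mem_stressSpace_iff.2 fun u => ?_
  ext l
  have h0 := h u none
  have hl := h u (some l)
  simp only [homogeneousCoord, Option.elim, mul_one] at h0 hl
  simp [mul_sub, Finset.sum_sub_distrib, ← Finset.sum_mul, h0, hl]

/-- The Bolker–Roth argument: a stress of a bipartite framework yields, through its vertex sums, a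
linear dependency between the symmetric squares of the points, which has to be trivial. -/
theorem isBalanced_of_mem_stressSpace {V : Type*} [Fintype V] {d : ℕ} {G : SimpleGraph V}
    {p : V → EuclideanSpace ℝ (Fin d)} (hp : IsGenericRealization p)
    (hV : Fintype.card V = (d + 2).choose 2) {ε : V → ℝ} (hε : ∀ v, ε v ≠ 0)
    (hadj : ∀ u v, G.Adj u v → ε v = -ε u) {ω : G.edgeSet → ℝ} (hω : ω ∈ stressSpace G p) :
    IsBalanced p (edgeWeight G ω) := by
  set w := edgeWeight G ω with hw
  have heq : ∀ u x, ∑ v, w u v * homogeneousCoord (p v) x =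
      (∑ v, w u v) * homogeneousCoord (p u) x := by
    rintro u (_ | l)
    · simp [homogeneousCoord]
    · have h := congrArg (fun q => q l) (mem_stressSpace_iff.1 hω u)
      simpa [mul_sub, Finset.sum_sub_distrib, ← Finset.sum_mul, homogeneousCoord, sub_eq_zero,
        hw] using h
  have hsign : ∀ u v, ε u * w u v = -(ε v * w v u) := by
    intro u v
    by_cases h : G.Adj u v
    · rw [hadj u v h, hw, edgeWeight_comm ω v u]
      ring
    · rw [hw, edgeWeight_comm ω v u, edgeWeight_of_not_adj ω h]
      simp
  have hexp : ∀ x y, ∑ u, ε u * (∑ v, w u v) *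
      (homogeneousCoord (p u) x * homogeneousCoord (p u) y) =
      ∑ u, ∑ v, ε u * w u v * (homogeneousCoord (p v) x * homogeneousCoord (p u) y) := by
    intro x y
    refine Finset.sum_congr rfl fun u _ => ?_
    calc _ = ε u * homogeneousCoord (p u) y *
          ((∑ v, w u v) * homogeneousCoord (p u) x) := by ring
      _ = _ := by
        rw [← heq, Finset.mul_sum]
        exact Finset.sum_congr rfl fun v _ => by ring
  have hc := eq_zero_of_sum_quadratic_eq_zero hp hV (fun u => ε u * ∑ v, w u v) (by
    intro x y
    -- The sum is symmetric in `x` and `y`, and the exchange of `u` and `v` shows that it is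
    -- antisymmetric.
    have hanti : ∑ u, ε u * (∑ v, w u v) *
          (homogeneousCoord (p u) x * homogeneousCoord (p u) y) =
        -∑ u, ε u * (∑ v, w u v) *
          (homogeneousCoord (p u) x * homogeneousCoord (p u) y) := by
      conv_rhs =>
        enter [1, 2, u]
        rw [mul_comm (homogeneousCoord (p u) x)]
      rw [hexp x y, hexp y x, Finset.sum_comm, ← Finset.sum_neg_distrib]
      refine Finset.sum_congr rfl fun v _ => ?_
      rw [← Finset.sum_neg_distrib]
      refine Finset.sum_congr rfl fun u _ => ?_
      rw [hsign u v]
      ring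
    exact self_eq_neg.1 hanti)
  intro u x
  have hu : ∑ v, w u v = 0 := (mul_eq_zero.1 (congrFun hc u)).resolve_left (hε u)
  rw [heq, hu, zero_mul]

/-! ### Extension by zero -/

theorem edgeWeight_extend {V W : Type*} {G : SimpleGraph V} {H : SimpleGraph W} (φ : H ↪g G)
    (ω : H.edgeSet → ℝ) (u v : W) :
    edgeWeight G (Function.ExtendByZero.linearMap ℝ φ.mapEdgeSet ω) (φ u) (φ v) =
      edgeWeight H ω u v := by
  by_cases h : H.Adj u v
  · rw [edgeWeight_of_adj ω h, edgeWeight_of_adj _ (φ.map_adj_iff.2 h)]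
    exact φ.mapEdgeSet.injective.extend_apply ω 0 ⟨s(u, v), h⟩
  · rw [edgeWeight_of_not_adj ω h, edgeWeight_of_not_adj _ fun h' => h (φ.map_adj_iff.1 h')]

theorem edgeWeight_extend_of_notMem_range {V W : Type*} {G : SimpleGraph V} {H : SimpleGraph W}
    (φ : H ↪g G) (ω : H.edgeSet → ℝ) {u v : V} (h : u ∉ Set.range φ ∨ v ∉ Set.range φ) :
    edgeWeight G (Function.ExtendByZero.linearMap ℝ φ.mapEdgeSet ω) u v = 0 := by
  by_cases hadj : G.Adj u v
  · rw [edgeWeight_of_adj _ hadj]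
    refine Function.extend_apply' ω (0 : G.edgeSet → ℝ) _ ?_
    rintro ⟨⟨e, he⟩, h'⟩
    induction e with | _ i j
    have h'' : s(φ i, φ j) = s(u, v) := congrArg Subtype.val h'
    rcases Sym2.eq_iff.1 h'' with ⟨rfl, rfl⟩ | ⟨rfl, rfl⟩ <;> simp at h
  · exact edgeWeight_of_not_adj _ hadj

theorem extend_mem_stressSpace_iff {V W : Type*} [Fintype V] [Fintype W] {d : ℕ}
    {G : SimpleGraph V} {H : SimpleGraph W} (φ : H ↪g G) {p : V → EuclideanSpace ℝ (Fin d)}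
    {ω : H.edgeSet → ℝ} :
    Function.ExtendByZero.linearMap ℝ φ.mapEdgeSet ω ∈ stressSpace G p ↔
      ω ∈ stressSpace H (p ∘ φ) := by
  have key : ∀ i : W, ∑ j, edgeWeight H ω i j • ((p ∘ φ) j - (p ∘ φ) i) =
      ∑ v, edgeWeight G (Function.ExtendByZero.linearMap ℝ φ.mapEdgeSet ω) (φ i) v •
        (p v - p (φ i)) := by
    intro i
    refine Fintype.sum_of_injective φ φ.injective _ _ ?_ ?_
    · intro v hv
      rw [edgeWeight_extend_of_notMem_range φ ω (Or.inr hv), zero_smul]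
    · intro j
      rw [edgeWeight_extend]
      rfl
  rw [mem_stressSpace_iff, mem_stressSpace_iff]
  refine ⟨fun h i => (key i).trans (h _), fun h u => ?_⟩
  by_cases hu : u ∈ Set.range φ
  · obtain ⟨i, rfl⟩ := hu
    exact (key i).symm.trans (h i)
  · exact Finset.sum_eq_zero fun v _ => by
      rw [edgeWeight_extend_of_notMem_range φ ω (Or.inl hu), zero_smul]

/-- A stress whose support lies in an induced subgraph is the extension by zero of a stress of the
subgraph. -/
theorem mem_map_extend_of_support {V W : Type*} [Fintype V] [Fintype W] {d : ℕ}
    {G : SimpleGraph V} {H : SimpleGraph W} (φ : H ↪g G) {p : V → EuclideanSpace ℝ (Fin d)}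
    {ω : G.edgeSet → ℝ} (hω : ω ∈ stressSpace G p)
    (hsupp : ∀ u v, edgeWeight G ω u v ≠ 0 → u ∈ Set.range φ ∧ v ∈ Set.range φ) :
    ω ∈ (stressSpace H (p ∘ φ)).map (Function.ExtendByZero.linearMap ℝ φ.mapEdgeSet) := by
  have h : Function.ExtendByZero.linearMap ℝ φ.mapEdgeSet (ω ∘ φ.mapEdgeSet) = ω := by
    ext ⟨e, he⟩
    by_cases hr : (⟨e, he⟩ : G.edgeSet) ∈ Set.range φ.mapEdgeSet
    · obtain ⟨e', h'⟩ := hr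
      rw [← h']
      exact φ.mapEdgeSet.injective.extend_apply _ (0 : G.edgeSet → ℝ) e'
    · refine (Function.extend_apply' _ (0 : G.edgeSet → ℝ) _ hr).trans ?_
      induction e with | _ u v
      by_contra h0
      obtain ⟨⟨i, rfl⟩, ⟨j, rfl⟩⟩ := hsupp u v (by
        rw [edgeWeight_of_adj ω he]
        exact Ne.symm h0)
      exact hr ⟨⟨s(i, j), φ.map_adj_iff.1 he⟩, rfl⟩
  rw [← h]
  exact Submodule.mem_map_of_mem ((extend_mem_stressSpace_iff φ).1 (h.symm ▸ hω))

/-! ### Peeling off three-chains -/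

theorem mem_range_threeChainEmbedding {k : ℕ} {a : Fin k → ℕ} (i : Fin (k - 2))
    {v : Σ i : Fin k, Fin (a i)} (h : (i : ℕ) ≤ v.1) (h' : (v.1 : ℕ) ≤ i + 2) :
    v ∈ Set.range (threeChainEmbedding a i) := by
  obtain ⟨⟨c, hc⟩, x⟩ := v
  obtain ⟨j, rfl⟩ := Nat.exists_eq_add_of_le h
  exact ⟨⟨⟨j, by simp at h'; omega⟩, x⟩, rfl⟩

/-- Deleting an inner class separates the classes on its two sides. -/
theorem le_size_of_isVertexConnected {k : ℕ} {a : Fin k → ℕ} (ha : ∀ i, 0 < a i) {n : ℕ}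
    (hconn : IsVertexConnected (kChain a) n) (i : Fin k) (hi : 0 < (i : ℕ))
    (hi' : (i : ℕ) + 1 < k) : n ≤ a i := by
  by_contra! hlt
  let S : Finset (Σ i : Fin k, Fin (a i)) := Finset.univ.map (Function.Embedding.sigmaMk i)
  have hS : ∀ v : Σ i : Fin k, Fin (a i), v ∈ S ↔ v.1 = i := by
    rintro ⟨c, x⟩
    constructor
    · intro h
      obtain ⟨y, -, hy⟩ := Finset.mem_map.1 h
      exact (congrArg Sigma.fst hy).symm
    · rintro rfl
      exact Finset.mem_map.2 ⟨x, Finset.mem_univ _, rfl⟩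
  have hcon := (hconn.2 S (by simpa [S] using hlt)).preconnected
  let u : Σ i : Fin k, Fin (a i) := ⟨⟨0, by omega⟩, ⟨0, ha _⟩⟩
  let v : Σ i : Fin k, Fin (a i) := ⟨⟨i + 1, hi'⟩, ⟨0, ha _⟩⟩
  have hu : u ∈ ((S : Set (Σ i : Fin k, Fin (a i)))ᶜ) := by
    simp only [Set.mem_compl_iff, Finset.mem_coe, hS, Fin.ext_iff, u]
    omega
  have hv : v ∈ ((S : Set (Σ i : Fin k, Fin (a i)))ᶜ) := by
    simp only [Set.mem_compl_iff, Finset.mem_coe, hS, Fin.ext_iff, v]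
    omega
  have key : ∀ x y : ((S : Set (Σ i : Fin k, Fin (a i)))ᶜ : Set _),
      ((kChain a).induce ((S : Set (Σ i : Fin k, Fin (a i)))ᶜ)).Walk x y →
        (x.1.1 : ℕ) < i → (y.1.1 : ℕ) < i := by
    intro x y q
    induction q with
    | nil => exact id
    | @cons x z y h _ ih =>
      intro hx
      refine ih ?_
      have hz := z.2
      simp only [Set.mem_compl_iff, Finset.mem_coe, hS, Fin.ext_iff] at hz
      have h' : (x.1.1 : ℕ) + 1 = z.1.1 ∨ (z.1.1 : ℕ) + 1 = x.1.1 := h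
      omega
  obtain ⟨q⟩ := hcon ⟨u, hu⟩ ⟨v, hv⟩
  have := key _ _ q hi
  simp [v] at this

/-- Peeling off the first three classes: if `t` is the first class that meets the support of a
balanced weight function and the class `t + 2` affinely spans, then there is a balanced weight
function on the classes `t`, `t + 1` and `t + 2` with the same weights at the class `t`. -/
theorem exists_balanced_on_three_classes {k d : ℕ} {a : Fin k → ℕ}
    {p : (Σ i : Fin k, Fin (a i)) → EuclideanSpace ℝ (Fin d)} (hp : IsGenericRealization p)
    {t : ℕ} (ht : t + 2 < k) (hsize : d + 1 ≤ a ⟨t + 2, ht⟩)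
    {w : (Σ i : Fin k, Fin (a i)) → (Σ i : Fin k, Fin (a i)) → ℝ} (hcomm : ∀ u v, w u v = w v u)
    (hadj : ∀ u v, w u v ≠ 0 → (kChain a).Adj u v) (hbal : IsBalanced p w)
    (hsupp : ∀ u v, w u v ≠ 0 → t ≤ u.1) :
    ∃ w' : (Σ i : Fin k, Fin (a i)) → (Σ i : Fin k, Fin (a i)) → ℝ,
      (∀ u v, w' u v = w' v u) ∧ (∀ u v, w' u v ≠ 0 → (kChain a).Adj u v) ∧ IsBalanced p w' ∧
      (∀ u v, w' u v ≠ 0 → t ≤ u.1 ∧ (u.1 : ℕ) ≤ t + 2) ∧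
      ∀ u v, (u.1 : ℕ) = t → w' u v = w u v := by
  have hadj' : ∀ u v, w u v ≠ 0 → (u.1 : ℕ) + 1 = v.1 ∨ (v.1 : ℕ) + 1 = u.1 := hadj
  have hsupp' : ∀ u v, w u v ≠ 0 → t ≤ v.1 := fun u v h => hsupp v u (hcomm u v ▸ h)
  obtain ⟨R, hR0, hR⟩ := exists_dual_weights hp
    (Finset.univ.map (Function.Embedding.sigmaMk (β := fun i => Fin (a i)) ⟨t + 2, ht⟩))
    (by simpa using hsize)
  have hR2 : ∀ x v, R x v ≠ 0 → (v.1 : ℕ) = t + 2 := by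
    intro x v h
    by_contra h'
    refine h (hR0 x v fun hv => h' ?_)
    obtain ⟨y, -, rfl⟩ := Finset.mem_map.1 hv
    rfl
  -- `X u` is the force that the class `t` exerts on `u`; `B` cancels it by means of the class
  -- `t + 2`.
  let X : (Σ i : Fin k, Fin (a i)) → Option (Fin d) → ℝ := fun u x =>
    ∑ z, if (z.1 : ℕ) = t then w u z * homogeneousCoord (p z) x else 0
  let B : (Σ i : Fin k, Fin (a i)) → (Σ i : Fin k, Fin (a i)) → ℝ := fun u v =>
    ∑ x, X u x * R x v
  let C : (Σ i : Fin k, Fin (a i)) → (Σ i : Fin k, Fin (a i)) → ℝ := fun u v =>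
    if (u.1 : ℕ) = t ∨ (v.1 : ℕ) = t then w u v else 0
  have hX : ∀ u x, X u x ≠ 0 → (u.1 : ℕ) = t + 1 := by
    intro u x h
    obtain ⟨z, -, hz⟩ := Finset.exists_ne_zero_of_sum_ne_zero h
    split_ifs at hz with hzt
    · have h1 := left_ne_zero_of_mul hz
      have h2 := hadj' _ _ h1
      have h3 := hsupp _ _ h1
      omega
    · exact absurd rfl hz
  have hB : ∀ u v, B u v ≠ 0 → (u.1 : ℕ) = t + 1 ∧ (v.1 : ℕ) = t + 2 := by
    intro u v h
    obtain ⟨x, -, hx⟩ := Finset.exists_ne_zero_of_sum_ne_zero h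
    exact ⟨hX u x (left_ne_zero_of_mul hx), hR2 x v (right_ne_zero_of_mul hx)⟩
  have hC : ∀ u v, C u v ≠ 0 → w u v ≠ 0 ∧ ((u.1 : ℕ) = t ∨ (v.1 : ℕ) = t) := by
    intro u v h
    by_cases h' : (u.1 : ℕ) = t ∨ (v.1 : ℕ) = t
    · exact ⟨by simpa only [C, if_pos h'] using h, h'⟩
    · exact absurd (if_neg h') h
  have hcases : ∀ u v, C u v - B u v - B v u ≠ 0 → C u v ≠ 0 ∨ B u v ≠ 0 ∨ B v u ≠ 0 := by
    intro u v h
    by_contra! h'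
    exact h (by rw [h'.1, h'.2.1, h'.2.2]; ring)
  have hBsum : ∀ u y, ∑ v, B u v * homogeneousCoord (p v) y = X u y := by
    intro u y
    simp only [B, Finset.sum_mul]
    rw [Finset.sum_comm]
    simp only [mul_assoc, ← Finset.mul_sum, hR]
    simp
  have hXsum : ∀ x y, ∑ v, X v x * homogeneousCoord (p v) y = 0 := by
    intro x y
    simp only [X, Finset.sum_mul]
    rw [Finset.sum_comm]
    refine Finset.sum_eq_zero fun z _ => ?_
    split_ifs with hz
    · calc _ = homogeneousCoord (p z) x * ∑ v, w z v * homogeneousCoord (p v) y := by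
            rw [Finset.mul_sum]
            exact Finset.sum_congr rfl fun v _ => by rw [hcomm v z]; ring
        _ = 0 := by rw [hbal, mul_zero]
    · simp
  have hBsum' : ∀ u y, ∑ v, B v u * homogeneousCoord (p v) y = 0 := by
    intro u y
    simp only [B, Finset.sum_mul]
    rw [Finset.sum_comm]
    refine Finset.sum_eq_zero fun x _ => ?_
    calc _ = R x u * ∑ v, X v x * homogeneousCoord (p v) y := by
          rw [Finset.mul_sum]
          exact Finset.sum_congr rfl fun v _ => by ring
      _ = 0 := by rw [hXsum, mul_zero]
  have hCsum : ∀ u y, ∑ v, C u v * homogeneousCoord (p v) y = X u y := by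
    intro u y
    by_cases hu : (u.1 : ℕ) = t
    · have h0 : X u y = 0 := by
        by_contra h
        have := hX u y h
        omega
      rw [h0, ← hbal u y]
      simp [C, hu]
    · simp [C, X, hu]
  refine ⟨fun u v => C u v - B u v - B v u, ?_, ?_, ?_, ?_, ?_⟩
  · intro u v
    simp only [C, hcomm u v, or_comm]
    ring
  · intro u v h
    rcases hcases u v h with h | h | h
    · exact hadj u v (hC u v h).1
    · have := hB u v h
      exact Or.inl (by omega)
    · have := hB v u h
      exact Or.inr (by omega)
  · intro u y
    simp only [sub_mul, Finset.sum_sub_distrib, hBsum, hBsum', hCsum]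
    ring
  · intro u v h
    rcases hcases u v h with h | h | h
    · have h1 := hC u v h
      have h2 := hadj' u v h1.1
      have h3 := hsupp u v h1.1
      omega
    · have := hB u v h
      omega
    · have := hB v u h
      omega
  · intro u v hu
    have h1 : B u v = 0 := by
      by_contra h
      have := hB u v h
      omega
    have h2 : B v u = 0 := by
      by_contra h
      have := hB v u h
      omega
    simp [h1, h2, C, hu]

theorem mem_coverStressSpace_of_isBalanced {k d : ℕ} {a : Fin k → ℕ}
    {p : (Σ i : Fin k, Fin (a i)) → EuclideanSpace ℝ (Fin d)} (hp : IsGenericRealization p)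
    (hsize : ∀ i : Fin k, 0 < (i : ℕ) → (i : ℕ) + 1 < k → d + 1 ≤ a i) (n : ℕ) :
    ∀ t, t + 3 + n = k → ∀ ω : (kChain a).edgeSet → ℝ, IsBalanced p (edgeWeight (kChain a) ω) →
      (∀ u v, edgeWeight (kChain a) ω u v ≠ 0 → t ≤ u.1) → ω ∈ coverStressSpace a p := by
  have base : ∀ (t : ℕ) (ht : t + 2 < k) (ω : (kChain a).edgeSet → ℝ),
      IsBalanced p (edgeWeight (kChain a) ω) →
      (∀ u v, edgeWeight (kChain a) ω u v ≠ 0 → t ≤ u.1 ∧ (u.1 : ℕ) ≤ t + 2) →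
      ω ∈ coverStressSpace a p := by
    intro t ht ω hbal hsupp
    refine Submodule.mem_iSup_of_mem (⟨t, by omega⟩ : Fin (k - 2)) ?_
    refine mem_map_extend_of_support _ hbal.mem_stressSpace fun u v h => ?_
    have hu := hsupp u v h
    have hv := hsupp v u (edgeWeight_comm ω u v ▸ h)
    exact ⟨mem_range_threeChainEmbedding _ hu.1 hu.2, mem_range_threeChainEmbedding _ hv.1 hv.2⟩
  induction n with
  | zero =>
    intro t ht ω hbal hsupp
    exact base t (by omega) ω hbal fun u v h => ⟨hsupp u v h, by omega⟩
  | succ n ih =>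
    intro t ht ω hbal hsupp
    have hadj : ∀ u v, edgeWeight (kChain a) ω u v ≠ 0 → (kChain a).Adj u v := by
      intro u v h
      by_contra h'
      exact h (edgeWeight_of_not_adj ω h')
    obtain ⟨w, hw, hwadj, hwbal, hwsupp, hwt⟩ := exists_balanced_on_three_classes hp
      (t := t) (by omega) (hsize _ (by simp) (by simp; omega)) (edgeWeight_comm ω) hadj hbal hsupp
    obtain ⟨ω', rfl⟩ := exists_edgeWeight_eq w hw hwadj
    have hrest : ω - ω' ∈ coverStressSpace a p := by
      refine ih (t + 1) (by omega) _ ?_ ?_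
      · intro u x
        simp only [edgeWeight_sub, sub_mul, Finset.sum_sub_distrib, hbal u x, hwbal u x, sub_zero]
      · intro u v h
        rw [edgeWeight_sub] at h
        have hle : t ≤ u.1 := by
          by_contra hlt
          have h1 : edgeWeight (kChain a) ω u v = 0 := by
            by_contra h1
            exact hlt (hsupp u v h1)
          have h2 : edgeWeight (kChain a) ω' u v = 0 := by
            by_contra h2
            exact hlt (hwsupp u v h2).1
          exact h (by rw [h1, h2, sub_zero])
        have hne : (u.1 : ℕ) ≠ t := fun hu => h (by rw [hwt u v hu, sub_self])
        omega
    have := Submodule.add_mem _ hrest (base t (by omega) ω' hwbal hwsupp)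
    rwa [sub_add_cancel] at this

theorem lemma4p1 (d k : ℕ) (hk : 4 ≤ k) (a : Fin k → ℕ) (ha : ∀ i, 0 < a i)
    (hconn : IsVertexConnected (kChain a) (d + 1))
    (hcard : ∑ i, a i = (d + 2).choose 2)
    (p : (Σ i : Fin k, Fin (a i)) → EuclideanSpace ℝ (Fin d))
    (hp : IsGenericRealization p) :
    stressSpace (kChain a) p = coverStressSpace a p := by
  apply le_antisymm
  · intro ω hω
    refine mem_coverStressSpace_of_isBalanced hp (le_size_of_isVertexConnected ha hconn) (k - 3) 0
      (by omega) ω ?_ fun _ _ _ => Nat.zero_le _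
    refine isBalanced_of_mem_stressSpace hp (by simpa using hcard)
      (ε := fun v => (-1) ^ (v.1 : ℕ)) (fun v => by simp) ?_ hω
    rintro u v (h | h)
    · simp only [← h, pow_succ]
      ring
    · simp only [← h, pow_succ]
      ring
  · refine iSup_le fun i => ?_
    rintro _ ⟨ω, hω, rfl⟩
    exact (extend_mem_stressSpace_iff _).2 hω
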